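/- Let $U=[0,1]^2$. For a finite set $S\subset U$, call an axis-aligned closed square $q$ (of positive side length) empty if no point of $S$ lies in the interior of $q$, and anchored at $s$ if $s$ is one of the four corners of $q$. The reach $R(S)$ is the union of all empty axis-aligned squares that are contained in $U$ and anchored at some point of $S$. Then for every nonempty finite set $S\subset U$ we have $\operatorname{area}(R(S))\ge \frac12$, and this bound is the best possible: for $S=\{(\frac12,0)\}$ we have $\operatorname{area}(R(S))=\frac12$. -/

import Mathlib

open MeasureTheory

namespace AnchoredSquares

/-- The unit square `U = [0,1]²`. -/
def unitSquare : Set (ℝ × ℝ) := Set.Icc 0 1 ×ˢ Set.Icc 0 1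

/-- An axis-aligned square in the plane: its lower-left corner is `(x, y)` and its
side length is `side > 0`. -/
structure Square where
  x : ℝ
  y : ℝ
  side : ℝ
  side_pos : 0 < side

/-- The closed region of the plane that is occupied by a square. -/
def Square.region (q : Square) : Set (ℝ × ℝ) :=
  Set.Icc q.x (q.x + q.side) ×ˢ Set.Icc q.y (q.y + q.side)

/-- The four corners of a square. -/
def Square.corners (q : Square) : Set (ℝ × ℝ) :=
  {(q.x, q.y), (q.x + q.side, q.y), (q.x, q.y + q.side), (q.x + q.side, q.y + q.side)}

/-- A square is empty (with respect to `S`) if no point of `S` lies in its interior. -/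
def Square.IsEmpty (q : Square) (S : Set (ℝ × ℝ)) : Prop :=
  ∀ s ∈ S, s ∉ interior q.region

/-- A square is anchored at the point `s` if `s` is one of its four corners. -/
def Square.AnchoredAt (q : Square) (s : ℝ × ℝ) : Prop := s ∈ q.corners

/-- The reach of `S`: the union of all empty axis-aligned squares contained in `U` and
anchored at some point of `S`. -/
def reach (S : Set (ℝ × ℝ)) : Set (ℝ × ℝ) :=
  {p | ∃ q : Square, q.region ⊆ unitSquare ∧ q.IsEmpty S ∧ (∃ s ∈ S, q.AnchoredAt s) ∧
    p ∈ q.region}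

end AnchoredSquares

namespace AnchoredSquares

/-! Suppose the reach has area `R < 1/2`. Let `p ∈ U` lie outside the reach and outside `S`, and let
`s` be a point of `S` nearest to `p` in the maximum norm, at distance `d`. Up to symmetry `s` lies
on the lower side of the ball around `p`, not to the right of `p`. The upper right square of side
`d` at `s` contains `p` and is empty, being inside the ball, so it must stick out of `U` on the
right: `1 - s.1 < d`. Such a `p` is a gap at the right side (`IsGap`).

A gap is charged to two squares in the reach, with `w = 1 - p.1` and `e = d - (p.1 - s.1)`: a near
square of side `w` in the strip between the gap and the right side of `U`, and a far square of side
`e` with lower right corner `s`. Let `W`, `E` be the suprema of `w`, `e` over the gaps at `s`. These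
gaps lie in a trapezoid of area `E W - W²/2`, and `4 (E W - W²/2) ≤ 2 W² + E²` because `(E - 2W)² ≥
0` (`volume_gaps_at_le`).

Near parts of the right and left gaps are disjoint from each other and from all far parts, and far
parts overlap at most twice, once for each side. Hence the lateral gaps have area at most `R/2`
(`volume_lateralGaps_le`). By transposition so do the vertical ones, and `unitSquare_subset` gives
`1 ≤ R + R/2 + R/2`. The assumption `R < 1/2` enters the geometry through `half_le_volume_of_full`,
which excludes balls that stick out of `U` on both sides. -/

theorem mem_unitSquare {p : ℝ × ℝ} :
    p ∈ unitSquare ↔ 0 ≤ p.1 ∧ p.1 ≤ 1 ∧ 0 ≤ p.2 ∧ p.2 ≤ 1 := by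
  simp only [unitSquare, Set.mem_prod, Set.mem_Icc, and_assoc]

theorem mem_reach {S : Set (ℝ × ℝ)} {p : ℝ × ℝ} :
    p ∈ reach S ↔ ∃ x y r : ℝ, 0 < r ∧ 0 ≤ x ∧ x + r ≤ 1 ∧ 0 ≤ y ∧ y + r ≤ 1 ∧
      (∀ t ∈ S, t.1 ≤ x ∨ x + r ≤ t.1 ∨ t.2 ≤ y ∨ y + r ≤ t.2) ∧
      ((x, y) ∈ S ∨ (x + r, y) ∈ S ∨ (x, y + r) ∈ S ∨ (x + r, y + r) ∈ S) ∧
      x ≤ p.1 ∧ p.1 ≤ x + r ∧ y ≤ p.2 ∧ p.2 ≤ y + r := by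
  constructor
  · rintro ⟨⟨x, y, r, hr⟩, hU, hE, ⟨s, hs, hA⟩, hp⟩
    simp only [Square.region] at hU hp
    have h1 : (x, y) ∈ unitSquare := hU ⟨⟨le_rfl, by simp; linarith⟩, ⟨le_rfl, by simp; linarith⟩⟩
    have h2 : (x + r, y + r) ∈ unitSquare :=
      hU ⟨⟨by simp; linarith, le_rfl⟩, ⟨by simp; linarith, le_rfl⟩⟩
    rw [mem_unitSquare] at h1 h2
    refine ⟨x, y, r, hr, h1.1, h2.2.1, h1.2.2.1, h2.2.2.2, ?_, ?_, hp.1.1, hp.1.2, hp.2.1, hp.2.2⟩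
    · intro t ht
      have := hE t ht
      simp only [Square.region, interior_prod_eq, interior_Icc, Set.mem_prod, Set.mem_Ioo] at this
      by_contra! h
      exact this ⟨⟨h.1, h.2.1⟩, h.2.2⟩
    · simp only [Square.AnchoredAt, Square.corners, Set.mem_insert_iff,
        Set.mem_singleton_iff] at hA
      rcases hA with rfl | rfl | rfl | rfl <;> simp [hs]
  · rintro ⟨x, y, r, hr, hx, hx1, hy, hy1, hE, hA, hp⟩
    refine ⟨⟨x, y, r, hr⟩, ?_, ?_, ?_, ⟨⟨hp.1, hp.2.1⟩, hp.2.2.1, hp.2.2.2⟩⟩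
    · rintro ⟨u, v⟩ ⟨⟨h1, h2⟩, h3, h4⟩
      rw [mem_unitSquare]
      simp only at h1 h2 h3 h4 ⊢
      exact ⟨by linarith, by linarith, by linarith, by linarith⟩
    · intro t ht
      simp only [Square.region, interior_prod_eq, interior_Icc, Set.mem_prod, Set.mem_Ioo]
      rintro ⟨⟨h1, h2⟩, h3, h4⟩
      rcases hE t ht with h | h | h | h <;> linarith
    · simp only [Square.AnchoredAt, Square.corners, Set.mem_insert_iff, Set.mem_singleton_iff]
      rcases hA with h | h | h | h
      · exact ⟨_, h, by simp⟩
      · exact ⟨_, h, by simp⟩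
      · exact ⟨_, h, by simp⟩
      · exact ⟨_, h, by simp⟩

/-- The square with lower left corner `s ∈ S` is part of the reach if it is empty. -/
theorem mem_reach_of_lowerLeft {S : Set (ℝ × ℝ)} (hU : S ⊆ unitSquare) {s p : ℝ × ℝ} (hs : s ∈ S)
    {r : ℝ} (hr : 0 < r) (hx : s.1 + r ≤ 1) (hy : s.2 + r ≤ 1)
    (hE : ∀ t ∈ S, t.1 ≤ s.1 ∨ s.1 + r ≤ t.1 ∨ t.2 ≤ s.2 ∨ s.2 + r ≤ t.2)
    (h1 : s.1 ≤ p.1) (h2 : p.1 ≤ s.1 + r) (h3 : s.2 ≤ p.2) (h4 : p.2 ≤ s.2 + r) :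
    p ∈ reach S := by
  have h := mem_unitSquare.1 (hU hs)
  exact mem_reach.2 ⟨s.1, s.2, r, hr, h.1, hx, h.2.2.1, hy, hE, Or.inl hs, h1, h2, h3, h4⟩

/-- The square with lower right corner `s ∈ S` is part of the reach if it is empty. -/
theorem mem_reach_of_lowerRight {S : Set (ℝ × ℝ)} (hU : S ⊆ unitSquare) {s p : ℝ × ℝ} (hs : s ∈ S)
    {r : ℝ} (hr : 0 < r) (hx : 0 ≤ s.1 - r) (hy : s.2 + r ≤ 1)
    (hE : ∀ t ∈ S, t.1 ≤ s.1 - r ∨ s.1 ≤ t.1 ∨ t.2 ≤ s.2 ∨ s.2 + r ≤ t.2)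
    (h1 : s.1 - r ≤ p.1) (h2 : p.1 ≤ s.1) (h3 : s.2 ≤ p.2) (h4 : p.2 ≤ s.2 + r) :
    p ∈ reach S := by
  have h := mem_unitSquare.1 (hU hs)
  refine mem_reach.2 ⟨s.1 - r, s.2, r, hr, hx, by linarith, h.2.2.1, hy, ?_, Or.inr (Or.inl ?_),
    h1, by linarith, h3, h4⟩
  · intro t ht
    rcases hE t ht with h | h | h | h
    · exact Or.inl h
    · exact Or.inr (Or.inl (by linarith))
    · exact Or.inr (Or.inr (Or.inl h))
    · exact Or.inr (Or.inr (Or.inr h))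
  · simpa using hs

/-! ### Symmetries of the unit square -/

/-- The reflection of the plane in the line `x = 1/2`. -/
noncomputable def flipX : (ℝ × ℝ) ≃ᵐ (ℝ × ℝ) :=
  (MeasurableEquiv.subLeft (1 : ℝ)).prodCongr (MeasurableEquiv.refl ℝ)

/-- The reflection of the plane in the line `y = 1/2`. -/
noncomputable def flipY : (ℝ × ℝ) ≃ᵐ (ℝ × ℝ) :=
  (MeasurableEquiv.refl ℝ).prodCongr (MeasurableEquiv.subLeft (1 : ℝ))

/-- The reflection of the plane in the diagonal. -/
noncomputable def transpose : (ℝ × ℝ) ≃ᵐ (ℝ × ℝ) := MeasurableEquiv.prodComm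

@[simp] theorem flipX_apply (p : ℝ × ℝ) : flipX p = (1 - p.1, p.2) := rfl
@[simp] theorem flipY_apply (p : ℝ × ℝ) : flipY p = (p.1, 1 - p.2) := rfl
@[simp] theorem transpose_apply (p : ℝ × ℝ) : transpose p = (p.2, p.1) := rfl

@[simp] theorem preimage_flipX_flipX (A : Set (ℝ × ℝ)) : flipX ⁻¹' (flipX ⁻¹' A) = A := by
  ext p; simp

@[simp] theorem preimage_flipY_flipY (A : Set (ℝ × ℝ)) : flipY ⁻¹' (flipY ⁻¹' A) = A := by
  ext p; simp

theorem measurePreserving_flipX : MeasurePreserving flipX :=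
  (Measure.measurePreserving_sub_left (volume : Measure ℝ) 1).prod (MeasurePreserving.id volume)

theorem measurePreserving_flipY : MeasurePreserving flipY :=
  (MeasurePreserving.id volume).prod (Measure.measurePreserving_sub_left (volume : Measure ℝ) 1)

theorem measurePreserving_transpose : MeasurePreserving transpose :=
  Measure.measurePreserving_swap

@[simp] theorem volume_preimage_flipX (A : Set (ℝ × ℝ)) : volume (flipX ⁻¹' A) = volume A :=
  measurePreserving_flipX.measure_preimage_equiv A

@[simp] theorem volume_preimage_flipY (A : Set (ℝ × ℝ)) : volume (flipY ⁻¹' A) = volume A :=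
  measurePreserving_flipY.measure_preimage_equiv A

@[simp] theorem volume_preimage_transpose (A : Set (ℝ × ℝ)) :
    volume (transpose ⁻¹' A) = volume A :=
  measurePreserving_transpose.measure_preimage_equiv A

theorem preimage_flipX_subset {S : Set (ℝ × ℝ)} (hU : S ⊆ unitSquare) :
    flipX ⁻¹' S ⊆ unitSquare := by
  intro p hp
  have := mem_unitSquare.1 (hU hp)
  simp only [flipX_apply] at this
  exact mem_unitSquare.2 ⟨by linarith, by linarith, this.2.2⟩

theorem preimage_flipY_subset {S : Set (ℝ × ℝ)} (hU : S ⊆ unitSquare) :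
    flipY ⁻¹' S ⊆ unitSquare := by
  intro p hp
  have := mem_unitSquare.1 (hU hp)
  simp only [flipY_apply] at this
  exact mem_unitSquare.2 ⟨this.1, this.2.1, by linarith, by linarith⟩

theorem preimage_transpose_subset {S : Set (ℝ × ℝ)} (hU : S ⊆ unitSquare) :
    transpose ⁻¹' S ⊆ unitSquare := by
  intro p hp
  have := mem_unitSquare.1 (hU hp)
  simp only [transpose_apply] at this
  exact mem_unitSquare.2 ⟨this.2.2.1, this.2.2.2, this.1, this.2.1⟩

theorem mem_reach_flipX {S : Set (ℝ × ℝ)} {p : ℝ × ℝ} (h : flipX p ∈ reach S) :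
    p ∈ reach (flipX ⁻¹' S) := by
  obtain ⟨x, y, r, hr, hx, hx1, hy, hy1, hE, hA, h1, h2, h3, h4⟩ := mem_reach.1 h
  simp only [flipX_apply] at h1 h2 h3 h4
  refine mem_reach.2 ⟨1 - x - r, y, r, hr, by linarith, by linarith, hy, hy1, ?_, ?_,
    by linarith, by linarith, h3, h4⟩
  · intro t ht
    have := hE _ ht
    simp only [flipX_apply] at this
    rcases this with h | h | h | h
    · exact Or.inr (Or.inl (by linarith))
    · exact Or.inl (by linarith)
    · exact Or.inr (Or.inr (Or.inl h))
    · exact Or.inr (Or.inr (Or.inr h))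
  · have e1 : 1 - (1 - x - r) = x + r := by ring
    have e2 : 1 - (1 - x - r + r) = x := by ring
    simp only [Set.mem_preimage, flipX_apply, e1, e2]
    tauto

theorem mem_reach_transpose {S : Set (ℝ × ℝ)} {p : ℝ × ℝ} (h : transpose p ∈ reach S) :
    p ∈ reach (transpose ⁻¹' S) := by
  obtain ⟨x, y, r, hr, hx, hx1, hy, hy1, hE, hA, h1, h2, h3, h4⟩ := mem_reach.1 h
  simp only [transpose_apply] at h1 h2 h3 h4
  refine mem_reach.2 ⟨y, x, r, hr, hy, hy1, hx, hx1, ?_, ?_, h3, h4, h1, h2⟩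
  · intro t ht
    have := hE _ ht
    simp only [transpose_apply] at this
    tauto
  · simp only [Set.mem_preimage, transpose_apply]
    tauto

theorem reach_flipX (S : Set (ℝ × ℝ)) : reach (flipX ⁻¹' S) = flipX ⁻¹' reach S := by
  ext p
  refine ⟨fun h => ?_, mem_reach_flipX⟩
  have := mem_reach_flipX (S := flipX ⁻¹' S) (p := flipX p) (by simpa using h)
  simpa using this

theorem reach_transpose (S : Set (ℝ × ℝ)) : reach (transpose ⁻¹' S) = transpose ⁻¹' reach S := by
  ext p
  refine ⟨fun h => ?_, mem_reach_transpose⟩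
  exact mem_reach_transpose (S := transpose ⁻¹' S) (p := transpose p) h

theorem reach_flipY (S : Set (ℝ × ℝ)) : reach (flipY ⁻¹' S) = flipY ⁻¹' reach S := by
  have key : ∀ A : Set (ℝ × ℝ), flipY ⁻¹' A = transpose ⁻¹' (flipX ⁻¹' (transpose ⁻¹' A)) :=
    fun A => rfl
  rw [key, reach_transpose, reach_flipX, reach_transpose]
  rfl

/-- If both upper squares at `s`, bounded by the left and the right side of `U`, are empty
squares in `U`, then they have total area at least one half. -/
theorem half_le_volume_of_full {S : Set (ℝ × ℝ)} (hU : S ⊆ unitSquare) {s : ℝ × ℝ} (hs : s ∈ S)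
    (hy : s.2 + s.1 ≤ 1) (hy' : s.2 + (1 - s.1) ≤ 1)
    (hl : ∀ t ∈ S, s.1 ≤ t.1 ∨ t.2 ≤ s.2 ∨ s.2 + s.1 ≤ t.2)
    (hr : ∀ t ∈ S, t.1 ≤ s.1 ∨ t.2 ≤ s.2 ∨ s.2 + (1 - s.1) ≤ t.2) :
    1 / 2 ≤ volume (reach S) := by
  have hsU := mem_unitSquare.1 (hU hs)
  have hsub : (Set.Ioo 0 s.1 ×ˢ Set.Ioo s.2 (s.2 + s.1)) ∪
      (Set.Ioo s.1 1 ×ˢ Set.Ioo s.2 (s.2 + (1 - s.1))) ⊆ reach S := by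
    rintro p (⟨⟨h1, h2⟩, h3, h4⟩ | ⟨⟨h1, h2⟩, h3, h4⟩)
    · refine mem_reach_of_lowerRight hU hs (r := s.1) (by linarith) (by linarith) hy ?_
        (by linarith) h2.le h3.le h4.le
      intro t ht
      exact Or.inr (hl t ht)
    · refine mem_reach_of_lowerLeft hU hs (r := 1 - s.1) (by linarith) (by linarith) hy' ?_
        h1.le (by linarith) h3.le h4.le
      intro t ht
      rcases hr t ht with h | h | h
      · exact Or.inl h
      · exact Or.inr (Or.inr (Or.inl h))
      · exact Or.inr (Or.inr (Or.inr h))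
  refine le_trans ?_ (measure_mono hsub)
  rw [measure_union _ (measurableSet_Ioo.prod measurableSet_Ioo)]
  · rw [Measure.volume_eq_prod, Measure.prod_prod, Measure.prod_prod]
    simp only [Real.volume_Ioo, sub_zero, add_sub_cancel_left]
    rw [← ENNReal.ofReal_mul hsU.1, ← ENNReal.ofReal_mul (by linarith),
      ← ENNReal.ofReal_add (by nlinarith) (by nlinarith)]
    have : (1 / 2 : ENNReal) = ENNReal.ofReal (1 / 2) := by
      rw [ENNReal.ofReal_div_of_pos (by norm_num)]; simp
    rw [this]
    apply ENNReal.ofReal_le_ofReal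
    nlinarith [sq_nonneg (2 * s.1 - 1)]
  · rw [Set.disjoint_left]
    rintro p ⟨⟨h1, h2⟩, h3, h4⟩ ⟨⟨h5, h6⟩, h7, h8⟩
    linarith

/-! ### Gaps and the parts of the reach charged for them -/

/-- A point `p` outside the reach whose distance `p.2 - s.2` from `S` in the maximum norm is
attained at a point `s` on the lower side of the ball around `p`, where `s` is not to the right
of `p`, and the upper right square at `s` through `p` sticks out of `U` on the right. -/
structure IsGap (S : Set (ℝ × ℝ)) (s p : ℝ × ℝ) : Prop where
  mem : s ∈ S
  notMem_reach : p ∉ reach S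
  le_fst : s.1 ≤ p.1
  fst_le_one : p.1 ≤ 1
  snd_le_one : p.2 ≤ 1
  wide : 1 - s.1 < p.2 - s.2
  -- The right side of the ball needs no alternative: by `wide` it lies outside `U`.
  empty : ∀ t ∈ S, t.1 ≤ p.1 - (p.2 - s.2) ∨ t.2 ≤ s.2 ∨ 2 * p.2 - s.2 ≤ t.2
  -- Breaks ties among points of equal height, so that no two of them carry gaps.
  leftmost : ∀ t ∈ S, t.2 = s.2 → t.1 < s.1 → p.2 - s.2 ≤ 1 - t.1

/-- All gaps that lie to the upper right of a point of `S`. -/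
def gapSet (S : Set (ℝ × ℝ)) : Set (ℝ × ℝ) := {p | ∃ s, IsGap S s p}

/-- The part of the reach between the gaps at `s` and the point `s`. -/
def nearAt (S : Set (ℝ × ℝ)) (s : ℝ × ℝ) : Set (ℝ × ℝ) :=
  {a | ∃ p, IsGap S s p ∧ p.1 < a.1 ∧ a.1 < 1 ∧ s.2 < a.2 ∧ a.2 < s.2 + (1 - p.1)}

/-- A part of the reach to the left of `s`, in the balls around the gaps at `s`. -/
def farAt (S : Set (ℝ × ℝ)) (s : ℝ × ℝ) : Set (ℝ × ℝ) :=
  {a | ∃ p, IsGap S s p ∧ p.1 - (p.2 - s.2) < a.1 ∧ a.1 < s.1 ∧ s.2 < a.2 ∧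
    a.2 < p.2 - (p.1 - s.1)}

def near (S : Set (ℝ × ℝ)) : Set (ℝ × ℝ) := ⋃ s ∈ S, nearAt S s

def far (S : Set (ℝ × ℝ)) : Set (ℝ × ℝ) := ⋃ s ∈ S, farAt S s

section Pointwise

variable {S : Set (ℝ × ℝ)} {s p a : ℝ × ℝ}

theorem mem_near : a ∈ near S ↔ ∃ s p, IsGap S s p ∧
    p.1 < a.1 ∧ a.1 < 1 ∧ s.2 < a.2 ∧ a.2 < s.2 + (1 - p.1) := by
  simp only [near, Set.mem_iUnion₂, nearAt, Set.mem_ofPred_eq]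
  exact ⟨fun ⟨s, _, p, h⟩ => ⟨s, p, h⟩, fun ⟨s, p, h⟩ => ⟨s, h.1.mem, p, h⟩⟩

theorem mem_far : a ∈ far S ↔ ∃ s p, IsGap S s p ∧ p.1 - (p.2 - s.2) < a.1 ∧ a.1 < s.1 ∧
    s.2 < a.2 ∧ a.2 < p.2 - (p.1 - s.1) := by
  simp only [far, Set.mem_iUnion₂, farAt, Set.mem_ofPred_eq]
  exact ⟨fun ⟨s, _, p, h⟩ => ⟨s, p, h⟩, fun ⟨s, p, h⟩ => ⟨s, h.1.mem, p, h⟩⟩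

theorem IsGap.mem_reach_of_near (hU : S ⊆ unitSquare) (h : IsGap S s p) (h1 : s.1 ≤ a.1)
    (h2 : a.1 ≤ 1) (h3 : s.2 ≤ a.2) (h4 : a.2 ≤ s.2 + (1 - s.1)) (hs : s.1 < 1) :
    a ∈ reach S := by
  have hy := h.snd_le_one
  have hw := h.wide
  have hx := h.le_fst
  have hx1 := h.fst_le_one
  refine mem_reach_of_lowerLeft hU h.mem (r := 1 - s.1) (by linarith) (by linarith)
    (by linarith) ?_ h1 (by linarith) h3 h4
  intro t ht
  rcases h.empty t ht with h | h | h
  · exact Or.inl (by linarith)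
  · exact Or.inr (Or.inr (Or.inl h))
  · exact Or.inr (Or.inr (Or.inr (by linarith)))

/-- The ball around a gap does not stick out of `U` on the left. -/
theorem IsGap.sub_nonneg (hU : S ⊆ unitSquare) (hR : volume (reach S) < 1 / 2)
    (h : IsGap S s p) : 0 ≤ p.1 - (p.2 - s.2) := by
  by_contra! hlt
  have hy := h.snd_le_one
  have hw := h.wide
  have hx := h.le_fst
  have hx1 := h.fst_le_one
  refine absurd (half_le_volume_of_full hU h.mem (by linarith) (by linarith) ?_ ?_) (not_le.2 hR)
  · intro t ht
    have := mem_unitSquare.1 (hU ht)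
    rcases h.empty t ht with h | h | h
    · linarith
    · exact Or.inr (Or.inl h)
    · exact Or.inr (Or.inr (by linarith))
  · intro t ht
    have := mem_unitSquare.1 (hU ht)
    rcases h.empty t ht with h | h | h
    · linarith
    · exact Or.inr (Or.inl h)
    · exact Or.inr (Or.inr (by linarith))

/-- The far square has its left side on that of the ball around `p` and stays inside the ball, hence
is empty; `sub_nonneg` keeps it in `U`. -/
theorem IsGap.mem_reach_of_far (hU : S ⊆ unitSquare) (hR : volume (reach S) < 1 / 2)
    (h : IsGap S s p) (h1 : p.1 - (p.2 - s.2) ≤ a.1) (h2 : a.1 ≤ s.1) (h3 : s.2 ≤ a.2)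
    (h4 : a.2 ≤ p.2 - (p.1 - s.1)) : a ∈ reach S := by
  have hy := h.snd_le_one
  have hw := h.wide
  have hx := h.le_fst
  have hx1 := h.fst_le_one
  have h0 := h.sub_nonneg hU hR
  refine mem_reach_of_lowerRight hU h.mem (r := p.2 - s.2 - (p.1 - s.1)) (by linarith)
    (by linarith) (by linarith) ?_ (by linarith) h2 h3 (by linarith)
  intro t ht
  rcases h.empty t ht with h | h | h
  · exact Or.inl (by linarith)
  · exact Or.inr (Or.inr (Or.inl h))
  · exact Or.inr (Or.inr (Or.inr (by linarith)))

theorem near_subset_reach (hU : S ⊆ unitSquare) : near S ⊆ reach S := by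
  intro a ha
  obtain ⟨s, p, h, h1, h2, h3, h4⟩ := mem_near.1 ha
  have hx := h.le_fst
  exact h.mem_reach_of_near hU (by linarith) h2.le h3.le (by linarith) (by linarith)

theorem far_subset_reach (hU : S ⊆ unitSquare) (hR : volume (reach S) < 1 / 2) :
    far S ⊆ reach S := by
  intro a ha
  obtain ⟨s, p, h, h1, h2, h3, h4⟩ := mem_far.1 ha
  exact h.mem_reach_of_far hU hR h1.le h2.le h3.le h4.le

/-! ### Disjointness of the charged parts -/

/-- There are gaps at no more than one point of `S` of any given height. -/
theorem IsGap.eq_of_snd_eq (hU : S ⊆ unitSquare) {t q : ℝ × ℝ} (hp : IsGap S s p)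
    (hq : IsGap S t q) (hst : s.2 = t.2) : s = t := by
  have key : ∀ s t p q : ℝ × ℝ, IsGap S s p → IsGap S t q → s.2 = t.2 → ¬ s.1 < t.1 := by
    intro s t p q hp hq hst hlt
    have h1 := hq.leftmost s hp.mem hst hlt
    have h2 := hq.wide
    have h3 := hq.le_fst
    have h4 := mem_unitSquare.1 (hU hq.mem)
    exact hq.notMem_reach
      (hp.mem_reach_of_near hU (by linarith) hq.fst_le_one (by linarith) (by linarith)
        (by linarith))
  ext
  · exact le_antisymm (not_lt.1 (key t s q p hq hp hst.symm)) (not_lt.1 (key s t p q hp hq hst))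
  · exact hst

/-- Makes the height bands from anchor to gap disjoint for different anchors. If `t` were inside the
band of `p`, it would be to the left of the ball around `p`, and its upper right square reaching the
side of `U` would cover `p`. -/
theorem IsGap.snd_add_le (hU : S ⊆ unitSquare) {t q : ℝ × ℝ} (hp : IsGap S s p)
    (hq : IsGap S t q) (hst : s.2 < t.2) : p.2 ≤ t.2 := by
  by_contra! hlt
  have h0 := hp.le_fst
  have h1 := hp.fst_le_one
  have h2 := hp.wide
  rcases hp.empty t hq.mem with h | h | h
  · exact hp.notMem_reach (hq.mem_reach_of_near hU (by linarith) h1 hlt.le (by linarith)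
      (by linarith))
  · linarith
  · linarith

theorem IsGap.bounds_of_mem_nearAt (ha : a ∈ nearAt S s) :
    ∃ p, IsGap S s p ∧ s.1 < a.1 ∧ s.2 < a.2 ∧ a.2 < p.2 := by
  obtain ⟨p, hp, h1, h2, h3, h4⟩ := ha
  have := hp.le_fst
  have := hp.wide
  exact ⟨p, hp, by linarith, h3, by linarith⟩

theorem IsGap.bounds_of_mem_farAt (ha : a ∈ farAt S s) :
    ∃ p, IsGap S s p ∧ a.1 < s.1 ∧ s.2 < a.2 ∧ a.2 < p.2 := by
  obtain ⟨p, hp, h1, h2, h3, h4⟩ := ha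
  have := hp.le_fst
  exact ⟨p, hp, h2, h3, by linarith⟩

theorem IsGap.eq_of_overlap (hU : S ⊆ unitSquare) {t q : ℝ × ℝ} (hp : IsGap S s p)
    (hq : IsGap S t q) (h1 : s.2 < a.2) (h2 : a.2 < p.2) (h3 : t.2 < a.2) (h4 : a.2 < q.2) :
    s = t := by
  rcases lt_trichotomy s.2 t.2 with h | h | h
  · have := hp.snd_add_le hU hq h
    linarith
  · exact hp.eq_of_snd_eq hU hq h
  · have := hq.snd_add_le hU hp h
    linarith

theorem pairwiseDisjoint_nearAt (hU : S ⊆ unitSquare) (A : Set (ℝ × ℝ)) :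
    A.PairwiseDisjoint (nearAt S) := by
  intro s _ t _ hst
  rw [Function.onFun, Set.disjoint_left]
  intro a ha hb
  obtain ⟨p, hp, -, h1, h2⟩ := IsGap.bounds_of_mem_nearAt ha
  obtain ⟨q, hq, -, h3, h4⟩ := IsGap.bounds_of_mem_nearAt hb
  exact hst (hp.eq_of_overlap hU hq h1 h2 h3 h4)

theorem pairwiseDisjoint_farAt (hU : S ⊆ unitSquare) (A : Set (ℝ × ℝ)) :
    A.PairwiseDisjoint (farAt S) := by
  intro s _ t _ hst
  rw [Function.onFun, Set.disjoint_left]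
  intro a ha hb
  obtain ⟨p, hp, -, h1, h2⟩ := IsGap.bounds_of_mem_farAt ha
  obtain ⟨q, hq, -, h3, h4⟩ := IsGap.bounds_of_mem_farAt hb
  exact hst (hp.eq_of_overlap hU hq h1 h2 h3 h4)

theorem disjoint_near_far (hU : S ⊆ unitSquare) : Disjoint (near S) (far S) := by
  rw [Set.disjoint_left]
  intro a ha hb
  simp only [near, far, Set.mem_iUnion₂] at ha hb
  obtain ⟨s, _, ha⟩ := ha
  obtain ⟨t, _, hb⟩ := hb
  obtain ⟨p, hp, h0, h1, h2⟩ := IsGap.bounds_of_mem_nearAt ha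
  obtain ⟨q, hq, h5, h3, h4⟩ := IsGap.bounds_of_mem_farAt hb
  have := hp.eq_of_overlap hU hq h1 h2 h3 h4
  subst this
  linarith

/-- The zones of upward and of downward gaps at the right side are at different heights. -/
theorem IsGap.not_overlap_flipY {t q : ℝ × ℝ} (hp : IsGap S s p)
    (hq : IsGap (flipY ⁻¹' S) t q) (h1 : s.2 < a.2) (h2 : a.2 < p.2) (h3 : t.2 < 1 - a.2)
    (h4 : 1 - a.2 < q.2) : False := by
  have e1 := hp.fst_le_one
  have e2 := hq.fst_le_one
  have e3 := hp.wide
  have e4 := hq.wide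
  -- The larger of the two balls would contain the anchor of the other gap in its interior.
  rcases le_total (q.2 - t.2) (p.2 - s.2) with h | h
  · have := hp.empty _ hq.mem
    simp only [flipY_apply] at this
    rcases this with h' | h' | h' <;> linarith
  · have := hq.empty (flipY s) (by simpa using hp.mem)
    simp only [flipY_apply] at this
    rcases this with h' | h' | h' <;> linarith

theorem exists_isGap_of_mem_near_union_far (ha : a ∈ near S ∪ far S) :
    ∃ s p, IsGap S s p ∧ s.2 < a.2 ∧ a.2 < p.2 := by
  simp only [near, far, Set.mem_union, Set.mem_iUnion₂] at ha
  rcases ha with ⟨s, _, ha⟩ | ⟨s, _, ha⟩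
  · obtain ⟨p, hp, _, h1, h2⟩ := IsGap.bounds_of_mem_nearAt ha
    exact ⟨s, p, hp, h1, h2⟩
  · obtain ⟨p, hp, _, h1, h2⟩ := IsGap.bounds_of_mem_farAt ha
    exact ⟨s, p, hp, h1, h2⟩

theorem disjoint_zone_flipY :
    Disjoint (near S ∪ far S) (flipY ⁻¹' (near (flipY ⁻¹' S) ∪ far (flipY ⁻¹' S))) := by
  rw [Set.disjoint_left]
  intro a ha hb
  obtain ⟨s, p, hp, h1, h2⟩ := exists_isGap_of_mem_near_union_far ha
  obtain ⟨t, q, hq, h3, h4⟩ := exists_isGap_of_mem_near_union_far hb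
  exact hp.not_overlap_flipY hq h1 h2 h3 h4

/-- Two gaps of the same height at opposite sides of `U`. -/
theorem IsGap.lt_of_snd_eq_flipX (hU : S ⊆ unitSquare) (hR : volume (reach S) < 1 / 2)
    {t q : ℝ × ℝ} (hp : IsGap S s p) (hq : IsGap (flipX ⁻¹' S) t q) (hst : s.2 = t.2) :
    1 - t.1 < s.1 := by
  by_contra! hle
  have e1 := hp.fst_le_one
  have e2 := hq.fst_le_one
  have e3 := hp.wide
  have e4 := hq.wide
  have e5 := hp.le_fst
  have e6 := hq.le_fst
  have e7 := hp.snd_le_one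
  have e8 := hq.snd_le_one
  -- Otherwise `s` inherits emptiness on its left from the ball around `q` and on its right from the
  -- ball around `p`.
  refine absurd (half_le_volume_of_full hU hp.mem (by linarith) (by linarith) ?_ ?_) (not_le.2 hR)
  · intro v hv
    have := hq.empty (flipX v) (by simpa using hv)
    simp only [flipX_apply] at this
    rcases this with h | h | h
    · exact Or.inl (by linarith)
    · exact Or.inr (Or.inl (by linarith))
    · exact Or.inr (Or.inr (by linarith))
  · intro v hv
    rcases hp.empty v hv with h | h | h
    · exact Or.inl (by linarith)
    · exact Or.inr (Or.inl h)
    · exact Or.inr (Or.inr (by linarith))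

theorem disjoint_near_near_flipX (hU : S ⊆ unitSquare) (hR : volume (reach S) < 1 / 2) :
    Disjoint (near S) (flipX ⁻¹' near (flipX ⁻¹' S)) := by
  rw [Set.disjoint_left]
  intro a ha hb
  obtain ⟨s, p, hp, h1, h2, h3, h4⟩ := mem_near.1 ha
  obtain ⟨t, q, hq, g1, g2, g3, g4⟩ := mem_near.1 hb
  simp only [flipX_apply] at g1 g2 g3 g4
  have e3 := hp.wide
  have e4 := hq.wide
  have e5 := hp.le_fst
  have e6 := hq.le_fst
  -- For different heights, the higher anchor falls inside the ball around the gap of the lower one.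
  rcases lt_trichotomy s.2 t.2 with h | h | h
  · have := hp.empty _ hq.mem
    simp only [flipX_apply] at this
    rcases this with h' | h' | h' <;> linarith
  · have := hp.lt_of_snd_eq_flipX hU hR hq h
    linarith
  · have := hq.empty (flipX s) (by simpa using hp.mem)
    simp only [flipX_apply] at this
    rcases this with h' | h' | h' <;> linarith

theorem disjoint_near_far_flipX (hU : S ⊆ unitSquare) (hR : volume (reach S) < 1 / 2) :
    Disjoint (near S) (flipX ⁻¹' far (flipX ⁻¹' S)) := by
  rw [Set.disjoint_left]
  intro a ha hb
  obtain ⟨s, p, hp, h1, h2, h3, h4⟩ := mem_near.1 ha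
  obtain ⟨t, q, hq, g1, g2, g3, g4⟩ := mem_far.1 hb
  simp only [flipX_apply] at g1 g2 g3 g4
  have e1 := hp.fst_le_one
  have e2 := hq.fst_le_one
  have e3 := hp.wide
  have e4 := hq.wide
  have e5 := hp.le_fst
  have e6 := hq.le_fst
  have e7 := hp.snd_le_one
  have e8 := hq.snd_le_one
  have hU' := preimage_flipX_subset hU
  have hR' : volume (reach (flipX ⁻¹' S)) < 1 / 2 := by rwa [reach_flipX, volume_preimage_flipX]
  -- The far square of the left gap would cover `p` itself.
  have hfar : 1 - t.1 ≤ p.1 → t.2 ≤ p.2 → p.2 ≤ q.2 - (q.1 - t.1) → False := by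
    intro i1 i2 i3
    have := hq.mem_reach_of_far hU' hR' (a := flipX p) (by simp; linarith) (by simp; linarith)
      i2 i3
    rw [reach_flipX] at this
    exact hp.notMem_reach (by simpa using this)
  rcases lt_trichotomy s.2 t.2 with h | h | h
  · have := hp.empty _ hq.mem
    simp only [flipX_apply] at this
    rcases this with h' | h' | h'
    · exact hfar (by linarith) (by linarith) (by linarith)
    · linarith
    · linarith
  · have hlt := hp.lt_of_snd_eq_flipX hU hR hq h
    rcases le_total p.2 (q.2 - (q.1 - t.1)) with i | i
    · exact hfar (by linarith) (by linarith) i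
    have hmem : (1 - t.1, t.2) ∈ S := hq.mem
    -- Now `p` is above the far square. The larger square of side `p.2 - s.2` at the same anchor
    -- covers `p` if it fits in `U`; if not, both upper squares at that anchor are full.
    by_cases i' : (1 - t.1) + (p.2 - s.2) ≤ 1
    · refine hp.notMem_reach (mem_reach_of_lowerLeft hU hmem (r := p.2 - s.2) (by linarith)
        i' (by simp only; linarith) ?_ (by simp only; linarith) (by simp only; linarith)
        (by simp only; linarith) (by simp only; linarith))
      intro v hv
      simp only
      rcases hp.empty v hv with h' | h' | h'
      · exact Or.inl (by linarith)
      · exact Or.inr (Or.inr (Or.inl (by linarith)))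
      · exact Or.inr (Or.inr (Or.inr (by linarith)))
    · refine absurd (half_le_volume_of_full hU hmem (by simp only; linarith)
        (by simp only; linarith) ?_ ?_) (not_le.2 hR)
      · intro v hv
        have := hq.empty (flipX v) (by simpa using hv)
        simp only [flipX_apply] at this ⊢
        rcases this with h' | h' | h'
        · exact Or.inl (by linarith)
        · exact Or.inr (Or.inl h')
        · exact Or.inr (Or.inr (by linarith))
      · intro v hv
        simp only
        rcases hp.empty v hv with h' | h' | h'
        · exact Or.inl (by linarith)
        · exact Or.inr (Or.inl (by linarith))
        · exact Or.inr (Or.inr (by linarith))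
  · have := hq.empty (flipX s) (by simpa using hp.mem)
    simp only [flipX_apply] at this
    rcases this with h' | h' | h' <;> linarith

theorem disjoint_near_near_flipXY :
    Disjoint (near S) (flipX ⁻¹' (flipY ⁻¹' near (flipX ⁻¹' (flipY ⁻¹' S)))) := by
  rw [Set.disjoint_left]
  intro a ha hb
  obtain ⟨s, p, hp, h1, h2, h3, h4⟩ := mem_near.1 ha
  obtain ⟨t, q, hq, g1, g2, g3, g4⟩ := mem_near.1 hb
  simp only [flipX_apply, flipY_apply] at g1 g2 g3 g4
  have e3 := hp.wide
  have e4 := hq.wide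
  have e5 := hp.le_fst
  have e6 := hq.le_fst
  have i1 := hp.empty _ hq.mem
  have i2 := hq.empty (flipX (flipY s)) (by simpa using hp.mem)
  simp only [flipX_apply, flipY_apply] at i1 i2
  rcases i1 with i1 | i1 | i1 <;> rcases i2 with i2 | i2 | i2 <;> linarith

/-- At a common point, the heights of the anchors would differ by less than the sum of the two
radii, and the larger ball would contain the anchor of the other gap. -/
theorem disjoint_near_far_flipXY :
    Disjoint (near S) (flipX ⁻¹' (flipY ⁻¹' far (flipX ⁻¹' (flipY ⁻¹' S)))) := by
  rw [Set.disjoint_left]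
  intro a ha hb
  obtain ⟨s, p, hp, h1, h2, h3, h4⟩ := mem_near.1 ha
  obtain ⟨t, q, hq, g1, g2, g3, g4⟩ := mem_far.1 hb
  simp only [flipX_apply, flipY_apply] at g1 g2 g3 g4
  have e3 := hp.wide
  have e4 := hq.wide
  have e5 := hp.le_fst
  have e6 := hq.le_fst
  have i1 := hp.empty _ hq.mem
  have i2 := hq.empty (flipX (flipY s)) (by simpa using hp.mem)
  simp only [flipX_apply, flipY_apply] at i1 i2
  rcases i1 with i1 | i1 | i1 <;> rcases i2 with i2 | i2 | i2 <;> linarith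

end Pointwise

/-! ### Area estimates for the gaps -/

theorem volume_trapezoid_le {k e w : ℝ} (hw : 0 ≤ w) (hwe : w ≤ e) :
    volume {z : ℝ × ℝ | 1 - w ≤ z.1 ∧ z.1 ≤ 1 ∧ k ≤ z.2 ∧ z.2 ≤ k + (z.1 - (1 - e))} ≤
      ENNReal.ofReal (e * w - w ^ 2 / 2) := by
  set T : Set (ℝ × ℝ) := {z | 1 - w ≤ z.1 ∧ z.1 ≤ 1 ∧ k ≤ z.2 ∧ z.2 ≤ k + (z.1 - (1 - e))}
  have hT : MeasurableSet T := by
    have h1 : IsClosed {z : ℝ × ℝ | 1 - w ≤ z.1} := isClosed_le (by fun_prop) (by fun_prop)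
    have h2 : IsClosed {z : ℝ × ℝ | z.1 ≤ 1} := isClosed_le (by fun_prop) (by fun_prop)
    have h3 : IsClosed {z : ℝ × ℝ | k ≤ z.2} := isClosed_le (by fun_prop) (by fun_prop)
    have h4 : IsClosed {z : ℝ × ℝ | z.2 ≤ k + (z.1 - (1 - e))} :=
      isClosed_le (by fun_prop) (by fun_prop)
    exact (h1.inter (h2.inter (h3.inter h4))).measurableSet
  have hsec : ∀ x, volume (Prod.mk x ⁻¹' T) ≤
      (Set.Icc (1 - w) 1).indicator (fun x => ENNReal.ofReal (x - (1 - e))) x := by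
    intro x
    by_cases hx : x ∈ Set.Icc (1 - w) 1
    · rw [Set.indicator_of_mem hx]
      refine (measure_mono (t := Set.Icc k (k + (x - (1 - e)))) ?_).trans ?_
      · rintro y ⟨-, -, h1, h2⟩
        exact ⟨h1, h2⟩
      · rw [Real.volume_Icc, add_sub_cancel_left]
    · rw [Set.indicator_of_notMem hx]
      have : Prod.mk x ⁻¹' T = ∅ := by
        ext y
        simp only [Set.mem_preimage, Set.mem_empty_iff_false, iff_false]
        rintro ⟨h1, h2, -⟩
        exact hx ⟨h1, h2⟩
      simp [this]
  calc volume T = ∫⁻ x, volume (Prod.mk x ⁻¹' T) := by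
        rw [Measure.volume_eq_prod, Measure.prod_apply hT]
    _ ≤ ∫⁻ x, (Set.Icc (1 - w) 1).indicator (fun x => ENNReal.ofReal (x - (1 - e))) x :=
        lintegral_mono hsec
    _ = ∫⁻ x in Set.Icc (1 - w) 1, ENNReal.ofReal (x - (1 - e)) :=
        lintegral_indicator measurableSet_Icc _
    _ = ENNReal.ofReal (∫ x in Set.Icc (1 - w) 1, (x - (1 - e))) := by
        rw [ofReal_integral_eq_lintegral_ofReal]
        · exact (Continuous.continuousOn (by fun_prop)).integrableOn_Icc
        · rw [Filter.EventuallyLE, ae_restrict_iff' measurableSet_Icc]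
          refine Filter.Eventually.of_forall fun x hx => ?_
          have := hx.1
          simp only [Pi.zero_apply]
          linarith
    _ = ENNReal.ofReal (e * w - w ^ 2 / 2) := by
        rw [integral_Icc_eq_integral_Ioc, ← intervalIntegral.integral_of_le (by linarith),
          intervalIntegral.integral_sub (by simp) (by simp), integral_id,
          intervalIntegral.integral_const]
        congr 1
        simp only [smul_eq_mul]
        ring

theorem volume_square (x y : ℝ) {r : ℝ} (hr : 0 ≤ r) :
    volume (Set.Ioo (x - r) x ×ˢ Set.Ioo y (y + r)) = ENNReal.ofReal (r ^ 2) := by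
  rw [Measure.volume_eq_prod, Measure.prod_prod, Real.volume_Ioo, Real.volume_Ioo,
    ← ENNReal.ofReal_mul (by linarith)]
  congr 1
  ring

variable {S : Set (ℝ × ℝ)}

theorem volume_gaps_at_le (hU : S ⊆ unitSquare) (s : ℝ × ℝ) :
    4 * volume {p | IsGap S s p} ≤ 2 * volume (nearAt S s) + volume (farAt S s) := by
  rcases Set.eq_empty_or_nonempty {p | IsGap S s p} with h0 | ⟨p₀, hp₀⟩
  · simp [h0]
  have hs := mem_unitSquare.1 (hU hp₀.mem)
  set W : Set ℝ := (fun p : ℝ × ℝ => 1 - p.1) '' {p | IsGap S s p}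
  set E : Set ℝ := (fun p : ℝ × ℝ => p.2 - s.2 - (p.1 - s.1)) '' {p | IsGap S s p}
  have hWne : W.Nonempty := ⟨_, p₀, hp₀, rfl⟩
  have hEne : E.Nonempty := ⟨_, p₀, hp₀, rfl⟩
  have hWb : BddAbove W := by
    refine ⟨1, ?_⟩
    rintro _ ⟨p, hp, rfl⟩
    have := hp.le_fst
    simp only
    linarith
  have hEb : BddAbove E := by
    refine ⟨1, ?_⟩
    rintro _ ⟨p, hp, rfl⟩
    have := hp.le_fst
    have := hp.snd_le_one
    simp only
    linarith
  have hWle : ∀ p, IsGap S s p → 1 - p.1 ≤ sSup W := fun p hp => le_csSup hWb ⟨p, hp, rfl⟩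
  have hEle : ∀ p, IsGap S s p → p.2 - s.2 - (p.1 - s.1) ≤ sSup E :=
    fun p hp => le_csSup hEb ⟨p, hp, rfl⟩
  have hW0 : 0 ≤ sSup W := by
    have := hWle p₀ hp₀
    have := hp₀.fst_le_one
    linarith
  have hWE : sSup W ≤ sSup E := by
    refine csSup_le hWne ?_
    rintro _ ⟨p, hp, rfl⟩
    have := hEle p hp
    have := hp.wide
    simp only
    linarith
  have hgap : volume {p | IsGap S s p} ≤
      ENNReal.ofReal (sSup E * sSup W - sSup W ^ 2 / 2) := by
    refine le_trans (measure_mono ?_) (volume_trapezoid_le (k := s.2 + (1 - s.1)) hW0 hWE)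
    intro p hp
    have h1 := hWle p hp
    have h2 := hEle p hp
    have h3 := IsGap.wide hp
    exact ⟨by linarith, IsGap.fst_le_one hp, by linarith, by linarith⟩
  have hnear : ENNReal.ofReal (sSup W ^ 2) ≤ volume (nearAt S s) := by
    rw [← volume_square 1 s.2 hW0]
    refine measure_mono ?_
    rintro a ⟨⟨h1, h2⟩, h3, h4⟩
    -- The near squares of the gaps at `s` are nested, so one gap with `w` close to `W` serves both
    -- coordinates; likewise for the far squares below.
    obtain ⟨_, ⟨p, hp, rfl⟩, hlt⟩ :=
      exists_lt_of_lt_csSup hWne (max_lt (show 1 - a.1 < sSup W by linarith)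
        (show a.2 - s.2 < sSup W by linarith))
    obtain ⟨i1, i2⟩ := max_lt_iff.1 hlt
    exact ⟨p, hp, by linarith, h2, h3, by linarith⟩
  have hfar : ENNReal.ofReal (sSup E ^ 2) ≤ volume (farAt S s) := by
    rw [← volume_square s.1 s.2 (hW0.trans hWE)]
    refine measure_mono ?_
    rintro a ⟨⟨h1, h2⟩, h3, h4⟩
    obtain ⟨_, ⟨p, hp, rfl⟩, hlt⟩ :=
      exists_lt_of_lt_csSup hEne (max_lt (show s.1 - a.1 < sSup E by linarith)
        (show a.2 - s.2 < sSup E by linarith))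
    obtain ⟨i1, i2⟩ := max_lt_iff.1 hlt
    exact ⟨p, hp, by linarith, h2, h3, by linarith⟩
  calc 4 * volume {p | IsGap S s p}
      ≤ 4 * ENNReal.ofReal (sSup E * sSup W - sSup W ^ 2 / 2) := by gcongr
    _ = ENNReal.ofReal (4 * (sSup E * sSup W - sSup W ^ 2 / 2)) := by
        rw [ENNReal.ofReal_mul (by norm_num)]; simp
    _ ≤ ENNReal.ofReal (2 * sSup W ^ 2 + sSup E ^ 2) :=
        ENNReal.ofReal_le_ofReal (by nlinarith [sq_nonneg (sSup E - 2 * sSup W)])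
    _ = 2 * ENNReal.ofReal (sSup W ^ 2) + ENNReal.ofReal (sSup E ^ 2) := by
        rw [ENNReal.ofReal_add (by positivity) (by positivity), ENNReal.ofReal_mul (by norm_num)]
        simp
    _ ≤ 2 * volume (nearAt S s) + volume (farAt S s) := by gcongr

theorem isOpen_nearAt (S : Set (ℝ × ℝ)) (s : ℝ × ℝ) : IsOpen (nearAt S s) := by
  have : nearAt S s = ⋃ p ∈ {p | IsGap S s p},
      Set.Ioo p.1 1 ×ˢ Set.Ioo s.2 (s.2 + (1 - p.1)) := by
    ext a
    simp only [nearAt, Set.mem_ofPred_eq, Set.mem_iUnion₂, Set.mem_prod, Set.mem_Ioo, and_assoc,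
      exists_prop]
  rw [this]
  exact isOpen_biUnion fun p _ => isOpen_Ioo.prod isOpen_Ioo

theorem isOpen_farAt (S : Set (ℝ × ℝ)) (s : ℝ × ℝ) : IsOpen (farAt S s) := by
  have : farAt S s = ⋃ p ∈ {p | IsGap S s p},
      Set.Ioo (p.1 - (p.2 - s.2)) s.1 ×ˢ Set.Ioo s.2 (p.2 - (p.1 - s.1)) := by
    ext a
    simp only [farAt, Set.mem_ofPred_eq, Set.mem_iUnion₂, Set.mem_prod, Set.mem_Ioo, and_assoc,
      exists_prop]
  rw [this]
  exact isOpen_biUnion fun p _ => isOpen_Ioo.prod isOpen_Ioo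

theorem measurableSet_near (S : Set (ℝ × ℝ)) : MeasurableSet (near S) :=
  (isOpen_biUnion fun s _ => isOpen_nearAt S s).measurableSet

theorem measurableSet_far (S : Set (ℝ × ℝ)) : MeasurableSet (far S) :=
  (isOpen_biUnion fun s _ => isOpen_farAt S s).measurableSet

theorem volume_gapSet_le (hfin : S.Finite) (hU : S ⊆ unitSquare) :
    4 * volume (gapSet S) ≤ 2 * volume (near S) + volume (far S) := by
  have hsub : gapSet S ⊆ ⋃ s ∈ hfin.toFinset, {p | IsGap S s p} := by
    rintro p ⟨s, hp⟩
    simp only [Set.Finite.mem_toFinset, Set.mem_iUnion₂]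
    exact ⟨s, hp.mem, hp⟩
  have hnear : volume (near S) = ∑ s ∈ hfin.toFinset, volume (nearAt S s) := by
    rw [← measure_biUnion_finset (pairwiseDisjoint_nearAt hU _)
      fun s _ => (isOpen_nearAt S s).measurableSet]
    simp [near]
  have hfar : volume (far S) = ∑ s ∈ hfin.toFinset, volume (farAt S s) := by
    rw [← measure_biUnion_finset (pairwiseDisjoint_farAt hU _)
      fun s _ => (isOpen_farAt S s).measurableSet]
    simp [far]
  calc 4 * volume (gapSet S) ≤ 4 * ∑ s ∈ hfin.toFinset, volume {p | IsGap S s p} := by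
        gcongr
        exact (measure_mono hsub).trans (measure_biUnion_finset_le _ _)
    _ = ∑ s ∈ hfin.toFinset, 4 * volume {p | IsGap S s p} := Finset.mul_sum _ _ _
    _ ≤ ∑ s ∈ hfin.toFinset, (2 * volume (nearAt S s) + volume (farAt S s)) :=
        Finset.sum_le_sum fun s _ => volume_gaps_at_le hU s
    _ = 2 * volume (near S) + volume (far S) := by
        rw [hnear, hfar, Finset.sum_add_distrib, Finset.mul_sum]

/-- The gaps at the right side of `U`. -/
def sideGaps (S : Set (ℝ × ℝ)) : Set (ℝ × ℝ) := gapSet S ∪ flipY ⁻¹' gapSet (flipY ⁻¹' S)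

def sideNear (S : Set (ℝ × ℝ)) : Set (ℝ × ℝ) := near S ∪ flipY ⁻¹' near (flipY ⁻¹' S)

def sideFar (S : Set (ℝ × ℝ)) : Set (ℝ × ℝ) := far S ∪ flipY ⁻¹' far (flipY ⁻¹' S)

theorem measurableSet_sideNear (S : Set (ℝ × ℝ)) : MeasurableSet (sideNear S) :=
  (measurableSet_near S).union (flipY.measurable (measurableSet_near _))

theorem measurableSet_sideFar (S : Set (ℝ × ℝ)) : MeasurableSet (sideFar S) :=
  (measurableSet_far S).union (flipY.measurable (measurableSet_far _))

theorem finite_preimage_equiv (hfin : S.Finite) (f : (ℝ × ℝ) ≃ᵐ (ℝ × ℝ)) : (f ⁻¹' S).Finite :=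
  hfin.preimage f.injective.injOn

theorem volume_sideGaps_le (hfin : S.Finite) (hU : S ⊆ unitSquare) :
    4 * volume (sideGaps S) ≤ 2 * volume (sideNear S) + volume (sideFar S) := by
  have hd := Set.disjoint_left.1 (disjoint_zone_flipY (S := S))
  have hN : volume (sideNear S) = volume (near S) + volume (near (flipY ⁻¹' S)) := by
    rw [sideNear, measure_union _ (flipY.measurable (measurableSet_near _)),
      volume_preimage_flipY]
    exact Set.disjoint_left.2 fun a ha hb => hd (Or.inl ha) (Or.inl hb)
  have hF : volume (sideFar S) = volume (far S) + volume (far (flipY ⁻¹' S)) := by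
    rw [sideFar, measure_union _ (flipY.measurable (measurableSet_far _)),
      volume_preimage_flipY]
    exact Set.disjoint_left.2 fun a ha hb => hd (Or.inr ha) (Or.inr hb)
  calc 4 * volume (sideGaps S)
      ≤ 4 * (volume (gapSet S) + volume (gapSet (flipY ⁻¹' S))) := by
        gcongr
        refine (measure_union_le _ _).trans_eq ?_
        rw [volume_preimage_flipY]
    _ = 4 * volume (gapSet S) + 4 * volume (gapSet (flipY ⁻¹' S)) := mul_add _ _ _
    _ ≤ (2 * volume (near S) + volume (far S)) +
        (2 * volume (near (flipY ⁻¹' S)) + volume (far (flipY ⁻¹' S))) :=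
        add_le_add (volume_gapSet_le hfin hU)
          (volume_gapSet_le (finite_preimage_equiv hfin _) (preimage_flipY_subset hU))
    _ = 2 * volume (sideNear S) + volume (sideFar S) := by
        rw [hN, hF]; ring

theorem volume_reach_flipX_lt (hR : volume (reach S) < 1 / 2) :
    volume (reach (flipX ⁻¹' S)) < 1 / 2 := by
  rwa [reach_flipX, volume_preimage_flipX]

theorem volume_reach_flipY_lt (hR : volume (reach S) < 1 / 2) :
    volume (reach (flipY ⁻¹' S)) < 1 / 2 := by
  rwa [reach_flipY, volume_preimage_flipY]

theorem disjoint_sideNear_sideFar (hU : S ⊆ unitSquare) :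
    Disjoint (sideNear S) (sideFar S) := by
  have hd := Set.disjoint_left.1 (disjoint_zone_flipY (S := S))
  have h1 := Set.disjoint_left.1 (disjoint_near_far hU)
  have h2 := Set.disjoint_left.1 (disjoint_near_far (preimage_flipY_subset hU))
  refine Set.disjoint_left.2 ?_
  rintro a (ha | ha) (hb | hb)
  · exact h1 ha hb
  · exact hd (Or.inl ha) (Or.inr hb)
  · exact hd (Or.inr hb) (Or.inl ha)
  · exact h2 ha hb

theorem disjoint_sideNear_flipX (hU : S ⊆ unitSquare) (hR : volume (reach S) < 1 / 2) :
    Disjoint (sideNear S) (flipX ⁻¹' (sideNear (flipX ⁻¹' S))) := by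
  have hU' := preimage_flipY_subset hU
  have hR' := volume_reach_flipY_lt hR
  have h1 := Set.disjoint_left.1 (disjoint_near_near_flipX hU hR)
  have h2 := Set.disjoint_left.1 (disjoint_near_near_flipX hU' hR')
  have h3 := Set.disjoint_left.1 (disjoint_near_near_flipXY (S := S))
  have h4 := Set.disjoint_left.1 (disjoint_near_near_flipXY (S := flipY ⁻¹' S))
  simp only [sideNear]
  refine Set.disjoint_left.2 ?_
  rintro a (ha | ha) (hb | hb)
  · exact h1 ha hb
  · exact h3 ha hb
  · refine h4 ha ?_
    simpa using hb
  · exact h2 ha hb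

theorem disjoint_sideNear_sideFar_flipX (hU : S ⊆ unitSquare) (hR : volume (reach S) < 1 / 2) :
    Disjoint (sideNear S) (flipX ⁻¹' (sideFar (flipX ⁻¹' S))) := by
  have hU' := preimage_flipY_subset hU
  have hR' := volume_reach_flipY_lt hR
  have h1 := Set.disjoint_left.1 (disjoint_near_far_flipX hU hR)
  have h2 := Set.disjoint_left.1 (disjoint_near_far_flipX hU' hR')
  have h3 := Set.disjoint_left.1 (disjoint_near_far_flipXY (S := S))
  have h4 := Set.disjoint_left.1 (disjoint_near_far_flipXY (S := flipY ⁻¹' S))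
  simp only [sideNear, sideFar]
  refine Set.disjoint_left.2 ?_
  rintro a (ha | ha) (hb | hb)
  · exact h1 ha hb
  · exact h3 ha hb
  · refine h4 ha ?_
    simpa using hb
  · exact h2 ha hb

theorem sideNear_subset_reach (hU : S ⊆ unitSquare) : sideNear S ⊆ reach S := by
  refine Set.union_subset (near_subset_reach hU) ?_
  have := near_subset_reach (preimage_flipY_subset hU)
  rw [reach_flipY] at this
  exact fun a ha => by simpa using this ha

theorem sideFar_subset_reach (hU : S ⊆ unitSquare) (hR : volume (reach S) < 1 / 2) :
    sideFar S ⊆ reach S := by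
  refine Set.union_subset (far_subset_reach hU hR) ?_
  have := far_subset_reach (preimage_flipY_subset hU) (volume_reach_flipY_lt hR)
  rw [reach_flipY] at this
  exact fun a ha => by simpa using this ha

/-- The gaps at the right and at the left side of `U`. -/
def lateralGaps (S : Set (ℝ × ℝ)) : Set (ℝ × ℝ) := sideGaps S ∪ flipX ⁻¹' sideGaps (flipX ⁻¹' S)

theorem volume_lateralGaps_le (hfin : S.Finite) (hU : S ⊆ unitSquare)
    (hR : volume (reach S) < 1 / 2) : 2 * volume (lateralGaps S) ≤ volume (reach S) := by
  have hU' := preimage_flipX_subset hU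
  have hR' := volume_reach_flipX_lt hR
  set N := sideNear S
  set F := sideFar S
  set N' := flipX ⁻¹' sideNear (flipX ⁻¹' S)
  set F' := flipX ⁻¹' sideFar (flipX ⁻¹' S)
  have mN' : MeasurableSet N' := flipX.measurable (measurableSet_sideNear _)
  have mF' : MeasurableSet F' := flipX.measurable (measurableSet_sideFar _)
  have dNN : Disjoint N N' := disjoint_sideNear_flipX hU hR
  have dNF : Disjoint N F := disjoint_sideNear_sideFar hU
  have dNF' : Disjoint N F' := disjoint_sideNear_sideFar_flipX hU hR
  have dN'F' : Disjoint N' F' := (disjoint_sideNear_sideFar hU').preimage _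
  have dN'F : Disjoint N' F := by
    have := (disjoint_sideNear_sideFar_flipX hU' hR').preimage flipX
    simpa using this
  have sN' : N' ⊆ reach S := by
    have := sideNear_subset_reach hU'
    rw [reach_flipX] at this
    exact fun a ha => by simpa using this ha
  have sF' : F' ⊆ reach S := by
    have := sideFar_subset_reach hU' hR'
    rw [reach_flipX] at this
    exact fun a ha => by simpa using this ha
  have hsub : (N ∪ N') ∪ (F ∪ F') ⊆ reach S :=
    Set.union_subset (Set.union_subset (sideNear_subset_reach hU) sN')
      (Set.union_subset (sideFar_subset_reach hU hR) sF')
  have hvol : volume N + volume N' + volume (F ∪ F') ≤ volume (reach S) := by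
    rw [← measure_union dNN mN',
      ← measure_union _ ((measurableSet_sideFar S).union mF')]
    · exact measure_mono hsub
    · exact (dNF.union_right dNF').union_left (dN'F.union_right dN'F')
  have hright := volume_sideGaps_le hfin hU
  have hleft := volume_sideGaps_le (finite_preimage_equiv hfin flipX) hU'
  rw [← volume_preimage_flipX (sideGaps _), ← volume_preimage_flipX (sideNear _),
    ← volume_preimage_flipX (sideFar _)] at hleft
  have key : 2 * (2 * volume (lateralGaps S)) ≤ 2 * volume (reach S) := by
    calc 2 * (2 * volume (lateralGaps S))
        ≤ 2 * (2 * (volume (sideGaps S) + volume (flipX ⁻¹' sideGaps (flipX ⁻¹' S)))) := by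
          gcongr
          exact measure_union_le _ _
      _ = 4 * volume (sideGaps S) + 4 * volume (flipX ⁻¹' sideGaps (flipX ⁻¹' S)) := by ring
      _ ≤ (2 * volume N + volume F) + (2 * volume N' + volume F') := add_le_add hright hleft
      -- `F` and `F'` may overlap, so each is bounded by their union; the weight 2 on the near parts
      -- matches this double count.
      _ ≤ (2 * volume N + volume (F ∪ F')) + (2 * volume N' + volume (F ∪ F')) := by
          gcongr
          · exact Set.subset_union_left
          · exact Set.subset_union_right
      _ = 2 * (volume N + volume N' + volume (F ∪ F')) := by ring
      _ ≤ 2 * volume (reach S) := by gcongr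
  exact (ENNReal.mul_le_mul_iff_right (by norm_num) (by norm_num)).1 key

/-! ### Every point of the square is reached, in `S`, or a gap -/

theorem mem_gapSet (hfin : S.Finite) (hU : S ⊆ unitSquare) {s p : ℝ × ℝ}
    (hs : s ∈ S) (hp : p ∈ unitSquare) (hpR : p ∉ reach S) (hx : s.1 ≤ p.1)
    (hd : 0 < p.2 - s.2) (hxy : p.1 - s.1 ≤ p.2 - s.2)
    (hE : ∀ t ∈ S, p.2 - s.2 ≤ |t.1 - p.1| ∨ p.2 - s.2 ≤ |t.2 - p.2|) : p ∈ gapSet S := by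
  have hpU := mem_unitSquare.1 hp
  have hw : 1 - s.1 < p.2 - s.2 := by
    by_contra! hle
    refine hpR (mem_reach_of_lowerLeft hU hs hd (by linarith) (by linarith) ?_ hx (by linarith)
      (by linarith) (by linarith))
    intro t ht
    rcases hE t ht with h | h
    · rcases le_abs.1 h with h | h
      · exact Or.inr (Or.inl (by linarith))
      · exact Or.inl (by linarith)
    · rcases le_abs.1 h with h | h
      · exact Or.inr (Or.inr (Or.inr (by linarith)))
      · exact Or.inr (Or.inr (Or.inl (by linarith)))
  -- The nearest point `s` may violate `leftmost`, so the anchor moves to the leftmost point of the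
  -- same height that still satisfies `wide`.
  set A : Set (ℝ × ℝ) := {t ∈ S | t.2 = s.2 ∧ t.1 ≤ s.1 ∧ 1 - t.1 < p.2 - s.2}
  obtain ⟨m, ⟨hmS, hm2, hm1, hmw⟩, hmin⟩ :=
    Set.exists_min_image A Prod.fst (hfin.subset fun t ht => ht.1) ⟨s, hs, rfl, le_rfl, hw⟩
  refine ⟨m, hmS, hpR, by linarith, hpU.2.1, hpU.2.2.2, by rwa [hm2], ?_, ?_⟩
  · intro t ht
    have := mem_unitSquare.1 (hU ht)
    rw [hm2]
    rcases hE t ht with h | h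
    · rcases le_abs.1 h with h | h
      · linarith
      · exact Or.inl (by linarith)
    · rcases le_abs.1 h with h | h
      · exact Or.inr (Or.inr (by linarith))
      · exact Or.inr (Or.inl (by linarith))
  · intro t ht ht2 ht1
    by_contra! hlt
    exact absurd (hmin t ⟨ht, ht2.trans hm2, by linarith, by rwa [hm2] at hlt⟩) (not_le.2 ht1)

theorem mem_sideGaps (hfin : S.Finite) (hU : S ⊆ unitSquare) {s p : ℝ × ℝ}
    (hs : s ∈ S) (hp : p ∈ unitSquare) (hpR : p ∉ reach S) (hx : s.1 ≤ p.1)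
    (hd : 0 < |s.2 - p.2|) (hxy : p.1 - s.1 ≤ |s.2 - p.2|)
    (hE : ∀ t ∈ S, |s.2 - p.2| ≤ |t.1 - p.1| ∨ |s.2 - p.2| ≤ |t.2 - p.2|) : p ∈ sideGaps S := by
  rcases le_total s.2 p.2 with h | h
  · rw [abs_sub_comm, abs_of_nonneg (sub_nonneg.2 h)] at hd hxy hE
    exact Or.inl (mem_gapSet hfin hU hs hp hpR hx hd hxy hE)
  · rw [abs_of_nonneg (sub_nonneg.2 h)] at hd hxy hE
    have e : (1 - p.2) - (1 - s.2) = s.2 - p.2 := by ring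
    refine Or.inr (mem_gapSet (s := flipY s) (finite_preimage_equiv hfin _)
      (preimage_flipY_subset hU) (by simpa using hs) (preimage_flipY_subset subset_rfl ?_) ?_ hx
      ?_ ?_ ?_)
    · simpa using hp
    · rw [reach_flipY]
      simpa using hpR
    · simpa [e] using hd
    · simpa [e] using hxy
    · intro t ht
      have := hE _ ht
      simp only [flipY_apply, e] at this ⊢
      rw [show t.2 - (1 - p.2) = -(1 - t.2 - p.2) by ring, abs_neg]
      exact this

theorem mem_lateralGaps (hfin : S.Finite) (hU : S ⊆ unitSquare) {s p : ℝ × ℝ}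
    (hs : s ∈ S) (hp : p ∈ unitSquare) (hpR : p ∉ reach S)
    (hd : 0 < |s.2 - p.2|) (hxy : |s.1 - p.1| ≤ |s.2 - p.2|)
    (hE : ∀ t ∈ S, |s.2 - p.2| ≤ |t.1 - p.1| ∨ |s.2 - p.2| ≤ |t.2 - p.2|) :
    p ∈ lateralGaps S := by
  rcases le_total s.1 p.1 with h | h
  · exact Or.inl (mem_sideGaps hfin hU hs hp hpR h hd
      ((le_abs_self _).trans ((abs_sub_comm _ _).trans_le hxy)) hE)
  · have e : (1 - p.1) - (1 - s.1) = s.1 - p.1 := by ring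
    refine Or.inr (mem_sideGaps (s := flipX s) (finite_preimage_equiv hfin _)
      (preimage_flipX_subset hU) (by simpa using hs) (preimage_flipX_subset subset_rfl ?_) ?_ ?_
      hd ?_ ?_)
    · simpa using hp
    · rw [reach_flipX]
      simpa using hpR
    · simp only [flipX_apply]
      linarith
    · simp only [flipX_apply, e]
      exact (le_abs_self _).trans hxy
    · intro t ht
      have := hE _ ht
      simp only [flipX_apply] at this ⊢
      rw [show t.1 - (1 - p.1) = -(1 - t.1 - p.1) by ring, abs_neg]
      exact this

theorem unitSquare_subset (hfin : S.Finite) (hne : S.Nonempty) (hU : S ⊆ unitSquare) :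
    unitSquare ⊆ reach S ∪ S ∪ lateralGaps S ∪ transpose ⁻¹' lateralGaps (transpose ⁻¹' S) := by
  intro p hp
  by_contra hnot
  simp only [Set.mem_union, not_or] at hnot
  obtain ⟨⟨⟨hpR, hpS⟩, hlat⟩, hver⟩ := hnot
  obtain ⟨s, hs, hmin⟩ :=
    Set.exists_min_image S (fun t => max |t.1 - p.1| |t.2 - p.2|) hfin hne
  rcases le_total |s.1 - p.1| |s.2 - p.2| with h | h
  · refine hlat (mem_lateralGaps hfin hU hs hp hpR ?_ h ?_)
    · refine (abs_nonneg _).lt_of_ne fun h0 => hpS ?_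
      rw [← h0] at h
      have h1 := abs_nonpos_iff.1 h
      have h2 := abs_eq_zero.1 h0.symm
      rwa [show p = s from Prod.ext (by linarith) (by linarith)]
    · intro t ht
      have := hmin t ht
      rw [max_eq_right h] at this
      exact le_max_iff.1 this
  · refine hver (mem_lateralGaps (s := transpose s) (finite_preimage_equiv hfin _)
      (preimage_transpose_subset hU) hs (preimage_transpose_subset subset_rfl hp) ?_ ?_ h ?_)
    · rw [reach_transpose]
      exact hpR
    · refine (abs_nonneg _).lt_of_ne fun h0 => hpS ?_
      have h0' : 0 = |s.1 - p.1| := h0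
      rw [← h0'] at h
      have h1 := abs_nonpos_iff.1 h
      have h2 := abs_eq_zero.1 h0'.symm
      rwa [show p = s from Prod.ext (by linarith) (by linarith)]
    · intro t ht
      have := hmin _ ht
      rw [max_eq_left h] at this
      exact (le_max_iff.1 this).symm

/-! ### The lower bound and its sharpness -/

theorem volume_unitSquare : volume unitSquare = 1 := by
  rw [unitSquare, Measure.volume_eq_prod, Measure.prod_prod]
  simp

theorem half_le_volume_reach (hfin : S.Finite) (hne : S.Nonempty) (hU : S ⊆ unitSquare) :
    1 / 2 ≤ volume (reach S) := by
  by_contra! hR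
  have h1 := volume_lateralGaps_le hfin hU hR
  have h2 := volume_lateralGaps_le (finite_preimage_equiv hfin transpose)
    (preimage_transpose_subset hU) (by rwa [reach_transpose, volume_preimage_transpose])
  rw [reach_transpose, volume_preimage_transpose] at h2
  have h3 : 1 ≤ volume (reach S) + volume (lateralGaps S) +
      volume (lateralGaps (transpose ⁻¹' S)) := by
    calc 1 = volume unitSquare := volume_unitSquare.symm
      _ ≤ _ := measure_mono (unitSquare_subset hfin hne hU)
      _ ≤ volume (reach S ∪ S ∪ lateralGaps S) +
          volume (transpose ⁻¹' lateralGaps (transpose ⁻¹' S)) := measure_union_le _ _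
      _ ≤ volume (reach S ∪ S) + volume (lateralGaps S) +
          volume (transpose ⁻¹' lateralGaps (transpose ⁻¹' S)) := by
          gcongr
          exact measure_union_le _ _
      _ ≤ volume (reach S) + volume S + volume (lateralGaps S) +
          volume (transpose ⁻¹' lateralGaps (transpose ⁻¹' S)) := by
          gcongr
          exact measure_union_le _ _
      _ = _ := by rw [hfin.measure_zero, add_zero, volume_preimage_transpose]
  have h4 : 2 * 1 ≤ 2 * (2 * volume (reach S)) := by
    calc 2 * 1 ≤ 2 * (volume (reach S) + volume (lateralGaps S) +
          volume (lateralGaps (transpose ⁻¹' S))) := by gcongr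
      _ = 2 * volume (reach S) + 2 * volume (lateralGaps S) +
          2 * volume (lateralGaps (transpose ⁻¹' S)) := by ring
      _ ≤ 2 * volume (reach S) + volume (reach S) + volume (reach S) := by gcongr
      _ = 2 * (2 * volume (reach S)) := by ring
  have h5 := (ENNReal.mul_le_mul_iff_right (by norm_num) (by norm_num)).1 h4
  exact absurd (ENNReal.div_le_of_le_mul' h5) (not_le.2 hR)

/-- A square in `U` with a corner at the midpoint of the bottom side extends to one side of it, so
its side is at most `1/2`. -/
theorem reach_bottom_midpoint_subset :
    reach {((1 / 2 : ℝ), (0 : ℝ))} ⊆ Set.Icc 0 1 ×ˢ Set.Icc 0 (1 / 2) := by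
  intro p hp
  obtain ⟨x, y, r, hr, hx, hx1, hy, hy1, -, hA, h1, h2, h3, h4⟩ := mem_reach.1 hp
  simp only [Set.mem_singleton_iff, Prod.mk.injEq] at hA
  refine ⟨⟨by linarith, by linarith⟩, by linarith, ?_⟩
  rcases hA with h | h | h | h <;> linarith [h.1, h.2]

end AnchoredSquares

theorem theorem1 :
    (∀ S : Set (ℝ × ℝ), S.Finite → S.Nonempty → S ⊆ AnchoredSquares.unitSquare →
      1 / 2 ≤ volume (AnchoredSquares.reach S)) ∧
    volume (AnchoredSquares.reach {((1 / 2 : ℝ), (0 : ℝ))}) = 1 / 2 := by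
  refine ⟨fun S h1 h2 h3 => AnchoredSquares.half_le_volume_reach h1 h2 h3, le_antisymm ?_ ?_⟩
  · refine (measure_mono AnchoredSquares.reach_bottom_midpoint_subset).trans ?_
    rw [Measure.volume_eq_prod, Measure.prod_prod]
    simp
  · refine AnchoredSquares.half_le_volume_reach (Set.finite_singleton _)
      (Set.singleton_nonempty _) ?_
    rw [Set.singleton_subset_iff, AnchoredSquares.mem_unitSquare]
    norm_num
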